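/- Let $N\ge 1$, $d\ge 0$, and consider the following forward $CM_c$ model for a sequence $x_0,\dots,x_N$ of $\mathbb R^d$-valued random vectors, $c\in\{0,N\}$: $$x_k=G_{k,k-1}x_{k-1}+G_{k,c}x_c+e_k,\qquad k\in\{1,\dots,N\}\setminus\{c\},\tag{1}$$ where the $G_{k,l}$ are real $d\times d$ matrices, $(e_k)_{k=0}^N$ is a zero-mean white Gaussian sequence (jointly Gaussian, $\operatorname{Cov}(e_k,e_l)=0$ for $k\ne l$) with positive definite covariances $G_k=\operatorname{Cov}(e_k)$, together with the boundary condition - for $c=N$: either (BC1) $x_0=e_0,\ x_N=G_{N,0}x_0+e_N$, or (BC2) $x_N=e_N,\ x_0=G_{0,N}x_N+e_0$; - for $c=0$: $x_0=e_0$. Let $G=\operatorname{diag}(G_0,\dots,G_N)$ and $A=\mathcal G'G^{-1}\mathcal G$ (the prime denotes transposition), where $\mathcal G$ is the $(N+1)\times(N+1)$ block matrix, with block rows and columns indexed by $0,\dots,N$, which has identity blocks on the diagonal and whose off-diagonal blocks are zero except for the following ones: - $c=N$, (BC1): $-G_{k,k-1}$ at $(k,k-1)$ and $-G_{k,N}$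 at $(k,N)$ for $1\le k\le N-1$, and $-G_{N,0}$ at $(N,0)$; - $c=N$, (BC2): $-G_{k,k-1}$ at $(k,k-1)$ and $-G_{k,N}$ at $(k,N)$ for $1\le k\le N-1$, and $-G_{0,N}$ at $(0,N)$; - $c=0$: $-2G_{1,0}$ at $(1,0)$, and $-G_{k,0}$ at $(k,0)$ and $-G_{k,k-1}$ at $(k,k-1)$ for $2\le k\le N$. In each of the three cases and for every choice of the parameters: the model has a solution, and every sequence $[x_k]$ governed by it (the equations holding almost surely) is zero-mean nonsingular Gaussian, meaning jointly Gaussian with invertible covariance matrix. Moreover, $[x_k]$ is reciprocal if and only if $A$ is cyclic (block) tridiagonal, that is, symmetric with $A_{k,l}=0$ whenever $|k-l|>1$ and $\{k,l\}\neq\{0,N\}$. In addition, $[x_k]$ is Markov if and only if $A$ is (block) tridiagonal, that is, symmetric with $A_{k,l}=0$ whenever $|k-l|>1$. Here $[x_k]$ is reciprocal if, for all $k_1<k_2$, the subsequences $(x_i)_{k_1<i<k_2}$ and $(x_i)_{i<k_1\text{ or }i>k_2}$ are conditionally independent given $(x_{k_1},x_{k_2})$, and Markov if, for every $k$, $(x_i)_{i<k}$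 and $(x_i)_{i>k}$ are conditionally independent given $x_k$. -/

import Mathlib

open MeasureTheory ProbabilityTheory

namespace CMSeq

variable {N d : ℕ} {Ω : Type*}

/-- The covariance matrix of a sequence `x_0, …, x_N` of `d`-dimensional random vectors, as an
`(N+1) × (N+1)` block matrix with `d × d` blocks. -/
noncomputable def covMatrix [MeasurableSpace Ω] (X : Fin (N + 1) → Ω → Fin d → ℝ)
    (μ : Measure Ω) : Matrix (Fin (N + 1) × Fin d) (Fin (N + 1) × Fin d) ℝ :=
  Matrix.of fun p q => covariance (fun ω => X p.1 ω p.2) (fun ω => X q.1 ω q.2) μ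

/-- A zero-mean (jointly) Gaussian sequence of random vectors. -/
structure IsZeroMeanGaussian [MeasurableSpace Ω] (X : Fin (N + 1) → Ω → Fin d → ℝ)
    (μ : Measure Ω) : Prop where
  measurable : ∀ k, Measurable (X k)
  gaussian : HasGaussianLaw (fun ω k => X k ω) μ
  mean_zero : ∀ k i, ∫ ω, X k ω i ∂μ = 0

/-- A zero-mean nonsingular Gaussian (ZMNG) sequence. -/
structure IsZMNG [MeasurableSpace Ω] (X : Fin (N + 1) → Ω → Fin d → ℝ)
    (μ : Measure Ω) : Prop extends IsZeroMeanGaussian X μ where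
  nonsingular : IsUnit (covMatrix X μ)

/-- The block diagonal matrix `diag(G_0, …, G_N)`. -/
def blockDiag (Γ : Fin (N + 1) → Matrix (Fin d) (Fin d) ℝ) :
    Matrix (Fin (N + 1) × Fin d) (Fin (N + 1) × Fin d) ℝ :=
  Matrix.comp _ _ _ _ _ (Matrix.diagonal Γ)

/-- A zero-mean white Gaussian sequence with covariances `Γ_k = Cov(e_k)`. -/
structure IsWhiteGaussian [MeasurableSpace Ω] (e : Fin (N + 1) → Ω → Fin d → ℝ)
    (Γ : Fin (N + 1) → Matrix (Fin d) (Fin d) ℝ) (μ : Measure Ω) : Prop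
    extends IsZeroMeanGaussian e μ where
  cov_eq : covMatrix e μ = blockDiag Γ

/-- The σ-algebra generated by the `x_k` with `k ∈ S`. -/
@[reducible] def sigmaOf (X : Fin (N + 1) → Ω → Fin d → ℝ) (S : Set (Fin (N + 1))) : MeasurableSpace Ω :=
  ⨆ k ∈ S, MeasurableSpace.comap (X k) inferInstance

/-- The σ-algebras `m₁` and `m₂` are conditionally independent given `m`:
`P(s ∩ t | m) = P(s | m) P(t | m)` almost surely for all `s ∈ m₁`, `t ∈ m₂`. (Mathlib's
`ProbabilityTheory.CondIndep` is this condition, but is only defined on standard Borel spaces.) -/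
def CondIndepGiven (m m₁ m₂ : MeasurableSpace Ω) {mΩ : MeasurableSpace Ω} (μ : Measure Ω) : Prop :=
  ∀ s t : Set Ω, MeasurableSet[m₁] s → MeasurableSet[m₂] t →
    μ[(s ∩ t).indicator (fun _ => (1 : ℝ)) | m] =ᵐ[μ]
      μ[s.indicator (fun _ => (1 : ℝ)) | m] * μ[t.indicator (fun _ => (1 : ℝ)) | m]

/-- A sequence is Markov iff, conditioned on the state at any time `k`, the subsequences before and
after `k` are independent. -/
def IsMarkov [MeasurableSpace Ω] (X : Fin (N + 1) → Ω → Fin d → ℝ) (μ : Measure Ω) : Prop :=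
  ∀ k : Fin (N + 1),
    CondIndepGiven (sigmaOf X {k}) (sigmaOf X {i | i < k}) (sigmaOf X {i | k < i}) μ

/-- A sequence is reciprocal iff, conditioned on the states at any two times `k₁ < k₂`, the
subsequences inside and outside the interval `[k₁, k₂]` are independent. -/
def IsReciprocal [MeasurableSpace Ω] (X : Fin (N + 1) → Ω → Fin d → ℝ) (μ : Measure Ω) : Prop :=
  ∀ k₁ k₂ : Fin (N + 1), k₁ < k₂ →
    CondIndepGiven (sigmaOf X {k₁, k₂}) (sigmaOf X {i | k₁ < i ∧ i < k₂})
      (sigmaOf X {i | i < k₁ ∨ k₂ < i}) μ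

/-- The three forms of the forward `CM_c` model: `c = N` with the boundary condition
`x_0 = e_0`, `x_N = G_{N,0} x_0 + e_N`; `c = N` with the boundary condition
`x_N = e_N`, `x_0 = G_{0,N} x_N + e_0`; and `c = 0`, where `x_0 = e_0`. -/
inductive ForwardModel
  | lastBC1
  | lastBC2
  | first

/-- The conditioning time `c`. -/
def ForwardModel.c : ForwardModel → Fin (N + 1)
  | .lastBC1 => Fin.last N
  | .lastBC2 => Fin.last N
  | .first => 0

/-- The boundary condition of the model at the sample point `ω`. -/
def ForwardModel.Boundary (b : ForwardModel)
    (G : Fin (N + 1) → Fin (N + 1) → Matrix (Fin d) (Fin d) ℝ)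
    (X e : Fin (N + 1) → Ω → Fin d → ℝ) (ω : Ω) : Prop :=
  match b with
  | .lastBC1 => X 0 ω = e 0 ω ∧
      X (Fin.last N) ω = (G (Fin.last N) 0).mulVec (X 0 ω) + e (Fin.last N) ω
  | .lastBC2 => X (Fin.last N) ω = e (Fin.last N) ω ∧
      X 0 ω = (G 0 (Fin.last N)).mulVec (X (Fin.last N) ω) + e 0 ω
  | .first => X 0 ω = e 0 ω

/-- `X` is governed by the forward `CM_c` model with coefficients `G_{k,l}`, noise covariances
`Γ_k` and noise sequence `e`: `x_k = G_{k,k-1} x_{k-1} + G_{k,c} x_c + e_k` for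
`k ∈ (0, N] \ {c}`, together with the boundary condition. Only those `G k l` which occur
in these equations matter. -/
structure Governs [MeasurableSpace Ω] (b : ForwardModel)
    (G : Fin (N + 1) → Fin (N + 1) → Matrix (Fin d) (Fin d) ℝ)
    (Γ : Fin (N + 1) → Matrix (Fin d) (Fin d) ℝ)
    (X e : Fin (N + 1) → Ω → Fin d → ℝ) (μ : Measure Ω) : Prop where
  measurable : ∀ k, Measurable (X k)
  noise : IsWhiteGaussian e Γ μ
  dynamics : ∀ᵐ ω ∂μ, ∀ j : Fin N, j.succ ≠ b.c →
    X j.succ ω = (G j.succ j.castSucc).mulVec (X j.castSucc ω)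
      + (G j.succ b.c).mulVec (X b.c ω) + e j.succ ω
  boundary : ∀ᵐ ω ∂μ, b.Boundary G X e ω

/-- The model matrix `𝒢`, block by block. For `c = 0` the block in row `1`, column `0` is
`-2 G_{1,0}`, since `x_{k-1}` and `x_c` are the same vector for `k = 1`. -/
def modelBlocks (b : ForwardModel) (G : Fin (N + 1) → Fin (N + 1) → Matrix (Fin d) (Fin d) ℝ) :
    Matrix (Fin (N + 1)) (Fin (N + 1)) (Matrix (Fin d) (Fin d) ℝ) :=
  match b with
  | .lastBC1 => Matrix.of fun k l =>
      if k = l then 1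
      else if k = 0 then 0
      else if k = Fin.last N then (if l = 0 then -G k l else 0)
      else if l = Fin.last N ∨ l.val + 1 = k.val then -G k l
      else 0
  | .lastBC2 => Matrix.of fun k l =>
      if k = l then 1
      else if k = Fin.last N then 0
      else if l = Fin.last N ∨ l.val + 1 = k.val then -G k l
      else 0
  | .first => Matrix.of fun k l =>
      if k = l then 1
      else if l = 0 then (if k.val = 1 then -((2 : ℝ) • G k l) else -G k l)
      else if l.val + 1 = k.val then -G k l
      else 0

/-- The model matrix `𝒢` as a real matrix. -/
def modelMatrix (b : ForwardModel) (G : Fin (N + 1) → Fin (N + 1) → Matrix (Fin d) (Fin d) ℝ) :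
    Matrix (Fin (N + 1) × Fin d) (Fin (N + 1) × Fin d) ℝ :=
  Matrix.comp _ _ _ _ _ (modelBlocks b G)

/-- The matrix `A = 𝒢' G⁻¹ 𝒢` with `G = diag(G_0, …, G_N)`. -/
noncomputable def matrixA (b : ForwardModel)
    (G : Fin (N + 1) → Fin (N + 1) → Matrix (Fin d) (Fin d) ℝ)
    (Γ : Fin (N + 1) → Matrix (Fin d) (Fin d) ℝ) :
    Matrix (Fin (N + 1) × Fin d) (Fin (N + 1) × Fin d) ℝ :=
  (modelMatrix b G).transpose * (blockDiag Γ)⁻¹ * modelMatrix b G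

/-- A symmetric block matrix is (block) tridiagonal if its block `(k, l)` vanishes whenever
`|k - l| > 1`. -/
def IsTridiagonal (A : Matrix (Fin (N + 1) × Fin d) (Fin (N + 1) × Fin d) ℝ) : Prop :=
  A.IsSymm ∧ ∀ k l : Fin (N + 1), (k.val + 1 < l.val ∨ l.val + 1 < k.val) →
    ∀ i j, A (k, i) (l, j) = 0

/-- A symmetric block matrix is cyclic (block) tridiagonal if its block `(k, l)` vanishes whenever
`|k - l| > 1` and `{k, l} ≠ {0, N}`. -/
def IsCyclicTridiagonal (A : Matrix (Fin (N + 1) × Fin d) (Fin (N + 1) × Fin d) ℝ) : Prop :=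
  A.IsSymm ∧ ∀ k l : Fin (N + 1), (k.val + 1 < l.val ∨ l.val + 1 < k.val) →
    ¬ (k = 0 ∧ l = Fin.last N) → ¬ (k = Fin.last N ∧ l = 0) →
    ∀ i j, A (k, i) (l, j) = 0

end CMSeq

namespace CMSeq

/-! ### Positive definite matrices and regression residuals -/

section LinearAlgebra

open Matrix

variable {n : Type*} [Fintype n]

/-! The model says `𝒢 x = e` almost surely, and `𝒢` is invertible (`modelMatrix_mulVec_eq_iff`,
`isUnit_modelMatrix`). So `x = 𝒢⁻¹ e` is Gaussian with covariance `C`, and `A C = 1`: `A` is the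
precision matrix of `x`.

For index sets `S, S₁, S₂` partitioning the times, `x_{S₁}` and `x_{S₂}` are conditionally
independent given `x_S` iff the block `A_{S₁,S₂}` vanishes (`Governs.condIndepGiven_iff`). Both
directions use the residual `∑ q, w q * x q` of one variable after regression on `x_S`; its
covariance with `x p` is `(C w) p`. If the block is zero, the residuals of `x_{S₁}` are uncorrelated
with `x_S` and `x_{S₂}`, hence independent of them, so `x_{S₂}` adds nothing to `x_S` in predicting
`x_{S₁}`. Conversely, conditional independence makes the residuals of `x_{S₂}` uncorrelated with
`x_{S₁}`, and positive definiteness then forces the block to vanish.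

Letting the separator `S` range over single times, respectively pairs of times, the required zero
blocks together are exactly those off the tridiagonal, respectively cyclic tridiagonal, pattern. -/

theorem eq_zero_of_posDef_of_mulVec_eq_zero_on {A : Matrix n n ℝ} (hA : A.PosDef) {T : Set n}
    {v : n → ℝ} (hv : ∀ p ∉ T, v p = 0) (hAv : ∀ p ∈ T, (A *ᵥ v) p = 0) : v = 0 := by
  by_contra h
  have h1 := hA.dotProduct_mulVec_pos h
  have h2 : star v ⬝ᵥ A *ᵥ v = 0 := by
    refine Finset.sum_eq_zero fun p _ => ?_
    by_cases hp : p ∈ T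
    · simp [hAv p hp]
    · simp [hv p hp]
  exact h1.ne' h2

/-- Linear regression: the coefficients of the residual of the variable `j` after regression on
the variables in `S`. -/
theorem exists_residual_coeff {C : Matrix n n ℝ} (hC : C.PosDef) {S : Set n} {j : n}
    (hj : j ∉ S) :
    ∃ w : n → ℝ, (∀ p, p ∉ S → p ≠ j → w p = 0) ∧ w j = 1 ∧ ∀ s ∈ S, (C *ᵥ w) s = 0 := by
  classical
  set D : Matrix S S ℝ := C.submatrix Subtype.val Subtype.val with hD
  have hDu : IsUnit D := (hC.submatrix Subtype.val_injective).isUnit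
  set b : S → ℝ := D⁻¹ *ᵥ fun s : S => C s j with hb
  have hDb : D *ᵥ b = fun s : S => C s j := by
    rw [hb, mulVec_mulVec, mul_nonsing_inv _ ((isUnit_iff_isUnit_det _).1 hDu), one_mulVec]
  refine ⟨fun p => if h : p ∈ S then -b ⟨p, h⟩ else if p = j then 1 else 0, ?_, ?_, ?_⟩
  · intro p hp hpj
    simp [hp, hpj]
  · simp [hj]
  · intro s hs
    have h1 := congrFun hDb ⟨s, hs⟩
    simp only [mulVec, dotProduct, hD, submatrix_apply] at h1 ⊢
    rw [← Fintype.sum_subtype_add_sum_subtype (· ∈ S),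
      Finset.sum_eq_single (⟨j, hj⟩ : {p // p ∉ S})]
    · simp [hj, h1]
    · rintro ⟨p, hp⟩ - hpj
      simp [hp, show p ≠ j from fun h => hpj (Subtype.ext h)]
    · simp

/-- On `S₂` the identity `A (C w) = w` reads `A_{S₂,S₂} (C w)_{S₂} = 0`: the `S`-part of `C w` is
zero and the `S₁`-columns of `A` drop out. A principal block of `A` is nonsingular. -/
theorem mulVec_residual_eq_zero {A C : Matrix n n ℝ} (hA : A.PosDef) (hAC : ∀ v, A *ᵥ (C *ᵥ v) = v)
    {S S₁ S₂ : Set n} (hcov : ∀ p, p ∈ S ∨ p ∈ S₁ ∨ p ∈ S₂)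
    (hz : ∀ p ∈ S₂, ∀ q ∈ S₁, A p q = 0) {w : n → ℝ} (hw : ∀ p ∈ S₂, w p = 0)
    (hCw : ∀ s ∈ S, (C *ᵥ w) s = 0) : ∀ p ∈ S₂, (C *ᵥ w) p = 0 := by
  classical
  set v := C *ᵥ w with hv
  set v' : n → ℝ := fun p => if p ∈ S₂ then v p else 0 with hv'
  have key : v' = 0 := by
    refine eq_zero_of_posDef_of_mulVec_eq_zero_on hA (T := S₂) (fun p hp => by simp [hv', hp]) ?_
    intro p hp
    rw [← hw p hp, ← hAC w]
    refine Finset.sum_congr rfl fun q _ => ?_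
    by_cases hq : q ∈ S₂
    · simp [hv', hq, hv]
    · rcases hcov q with h | h | h
      · simp [hv', hq, ← hv, hCw q h]
      · simp [hz p hp q h]
      · exact absurd h hq
  intro p hp
  simpa [hv', hp] using congrFun key p

/-- Let `a` be row `i` of `A` cut down to `S₂`; since `A (C w j) = w j`, it is orthogonal to each `C
w j`. The combination `c = ∑ a j • w j` agrees with `a` on `S₂`, where `C c` is supported, so `(C
c)' A (C c) = (C c)' c = (C c)' a = 0`. Hence `c = 0`, and so `a = 0`. -/
theorem eq_zero_of_mulVec_residual {A C : Matrix n n ℝ} (hA : A.PosDef)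
    (hAC : ∀ v, A *ᵥ (C *ᵥ v) = v) {S₂ : Set n} (w : n → n → ℝ)
    (hw1 : ∀ j ∈ S₂, w j j = 1) (hw0 : ∀ j ∈ S₂, ∀ p ∈ S₂, p ≠ j → w j p = 0)
    (hCw : ∀ j ∈ S₂, ∀ p ∉ S₂, (C *ᵥ w j) p = 0) {i : n}
    (hwi : ∀ j ∈ S₂, w j i = 0) : ∀ j ∈ S₂, A i j = 0 := by
  classical
  set a : n → ℝ := fun j => if j ∈ S₂ then A i j else 0 with ha
  have hav : ∀ j ∈ S₂, a ⬝ᵥ (C *ᵥ w j) = 0 := by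
    intro j hj
    rw [← hwi j hj, ← hAC (w j)]
    refine Finset.sum_congr rfl fun q _ => ?_
    by_cases hq : q ∈ S₂
    · simp [ha, hq, hAC]
    · simp [hCw j hj q hq, hAC]
  set c : n → ℝ := ∑ j, a j • w j with hc
  have hcS : ∀ p ∈ S₂, c p = a p := by
    intro p hp
    rw [hc, Finset.sum_apply, Finset.sum_eq_single p]
    · simp [hw1 p hp]
    · intro j _ hj
      by_cases hjS : j ∈ S₂
      · simp [hw0 j hjS p hp hj.symm]
      · simp [ha, hjS]
    · simp
  have hCc : C *ᵥ c = ∑ j, a j • (C *ᵥ w j) := by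
    rw [hc, mulVec_sum]
    simp [mulVec_smul]
  have hsupp : ∀ p ∉ S₂, (C *ᵥ c) p = 0 := by
    intro p hp
    rw [hCc, Finset.sum_apply]
    refine Finset.sum_eq_zero fun j _ => ?_
    by_cases hjS : j ∈ S₂
    · simp [hCw j hjS p hp]
    · simp [ha, hjS]
  have h0 : C *ᵥ c = 0 := by
    by_contra h
    have h1 := hA.dotProduct_mulVec_pos h
    rw [hAC] at h1
    have h2 : star (C *ᵥ c) ⬝ᵥ c = a ⬝ᵥ (C *ᵥ c) := by
      rw [dotProduct_comm]
      refine Finset.sum_congr rfl fun q _ => ?_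
      by_cases hq : q ∈ S₂
      · simp [hcS q hq]
      · simp [hsupp q hq]
    rw [h2] at h1
    refine h1.ne' ?_
    rw [hCc, dotProduct_sum]
    refine Finset.sum_eq_zero fun j _ => ?_
    by_cases hjS : j ∈ S₂
    · simp [hav j hjS]
    · simp [ha, hjS]
  have hc0 : c = 0 := by rw [← hAC c, h0, mulVec_zero]
  intro j hj
  have := hcS j hj
  simpa [hc0, ha, hj] using this.symm

end LinearAlgebra

/-! ### Conditional expectation and conditional independence -/

section CondExp

variable {Ω : Type*} {m m₁ m₂ mΩ : MeasurableSpace Ω} {μ : Measure Ω} [IsProbabilityMeasure μ]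

theorem integral_mul_condExp_of_stronglyMeasurable (hm : m ≤ mΩ) {f g : Ω → ℝ}
    (hf : StronglyMeasurable[m] f) (hg : Integrable g μ) (hfg : Integrable (f * g) μ) :
    ∫ ω, f ω * (μ[g | m]) ω ∂μ = ∫ ω, f ω * g ω ∂μ := by
  have h := condExp_mul_of_stronglyMeasurable_left hf hfg hg
  have h2 := integral_condExp (μ := μ) hm (f := f * g)
  rw [integral_congr_ae h] at h2
  exact h2

theorem integral_mul_eq_zero_of_forall_setIntegral_eq_zero (hm : m ≤ mΩ) {f k : Ω → ℝ}
    (hf : StronglyMeasurable[m] f) (hk : Integrable k μ) (hfk : Integrable (f * k) μ)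
    (h : ∀ s, MeasurableSet[m] s → ∫ ω in s, k ω ∂μ = 0) : ∫ ω, f ω * k ω ∂μ = 0 := by
  have h0 : (0 : Ω → ℝ) =ᵐ[μ] μ[k | m] := by
    refine ae_eq_condExp_of_forall_setIntegral_eq hm hk (fun _ _ _ => integrableOn_zero) ?_
      (by fun_prop)
    intro s hs _
    simp [h s hs]
  rw [← integral_mul_condExp_of_stronglyMeasurable hm hf hk hfk]
  refine integral_eq_zero_of_ae ?_
  filter_upwards [h0] with ω hω
  simp [← hω]

theorem ae_norm_condExp_indicator_le {ν : Measure Ω} (s : Set Ω) :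
    ∀ᵐ ω ∂ν, ‖(ν[s.indicator (fun _ => (1 : ℝ)) | m]) ω‖ ≤ 1 := by
  refine ae_bdd_abs_condExp_of_ae_bdd_abs (R := (1 : ℝ)) (Filter.Eventually.of_forall fun ω => ?_)
  by_cases h : ω ∈ s <;> simp [h]

/-- The product rule for events is extended one factor at a time: `t` is replaced by `g` with `s`
fixed, then `s` by `f`. -/
theorem CondIndepGiven.integral_mul_condExp (hm : m ≤ mΩ) (hm₁ : m₁ ≤ mΩ) (hm₂ : m₂ ≤ mΩ)
    (h : CondIndepGiven m m₁ m₂ μ) {f g : Ω → ℝ} (hf : StronglyMeasurable[m₁] f)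
    (hg : StronglyMeasurable[m₂] g) (hf2 : MemLp f 2 μ) (hg2 : MemLp g 2 μ) :
    ∫ ω, f ω * (g ω - (μ[g | m]) ω) ∂μ = 0 := by
  have hgi : Integrable g μ := hg2.integrable one_le_two
  have hci : Integrable (μ[g | m]) μ := integrable_condExp
  refine integral_mul_eq_zero_of_forall_setIntegral_eq_zero hm₁ hf (hgi.sub hci)
    (hf2.integrable_mul (hg2.sub (hg2.condExp one_le_two))) ?_
  intro s hs
  have hs' := hm₁ s hs
  set a : Ω → ℝ := s.indicator (fun _ => (1 : ℝ)) with ha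
  have hai : Integrable a μ := (integrable_const 1).indicator hs'
  set b : Ω → ℝ := μ[a | m] with hb
  have hbm : StronglyMeasurable[m] b := stronglyMeasurable_condExp
  have hbb : ∀ᵐ ω ∂μ, ‖b ω‖ ≤ 1 := ae_norm_condExp_indicator_le s
  have hab : ∀ ω, ‖a ω‖ ≤ 1 := fun ω => by by_cases h : ω ∈ s <;> simp [ha, h]
  have hbi : Integrable b μ := integrable_condExp
  have hag : ∀ {k : Ω → ℝ}, Integrable k μ → Integrable (k * a) μ := fun hk =>
    hk.mul_bdd hai.aestronglyMeasurable (Filter.Eventually.of_forall hab)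
  have hbg : ∀ {k : Ω → ℝ}, Integrable k μ → Integrable (k * b) μ := fun hk =>
    hk.mul_bdd hbi.aestronglyMeasurable hbb
  have hind : ∀ (t : Set Ω) (k : Ω → ℝ), MeasurableSet t →
      ∫ ω in t, k ω ∂μ = ∫ ω, k ω * t.indicator (fun _ => (1 : ℝ)) ω ∂μ := by
    intro t k ht
    rw [← integral_indicator ht]
    refine integral_congr_ae (Filter.Eventually.of_forall fun ω => ?_)
    by_cases h : ω ∈ t <;> simp [h]
  have h1 : ∫ ω, g ω * (a ω - b ω) ∂μ = 0 := by
    refine integral_mul_eq_zero_of_forall_setIntegral_eq_zero hm₂ hg (hai.sub hbi)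
      (((hag hgi).sub (hbg hgi)).congr (Filter.Eventually.of_forall fun ω => (mul_sub _ _ _).symm)) ?_
    intro t ht
    have ht' := hm₂ t ht
    have hti : Integrable (t.indicator (fun _ => (1 : ℝ))) μ := (integrable_const 1).indicator ht'
    have e1 : ∫ ω in t, a ω ∂μ = ∫ ω, (s ∩ t).indicator (fun _ => (1 : ℝ)) ω ∂μ := by
      rw [hind t a ht']
      refine integral_congr_ae (Filter.Eventually.of_forall fun ω => ?_)
      by_cases h : ω ∈ t <;> by_cases h' : ω ∈ s <;> simp [h, h', ha]
    have e2 : ∫ ω in t, b ω ∂μ = ∫ ω, (s ∩ t).indicator (fun _ => (1 : ℝ)) ω ∂μ := by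
      rw [hind t b ht', ← integral_mul_condExp_of_stronglyMeasurable hm hbm hti
        (by simpa [mul_comm] using hbg hti), ← integral_condExp hm (f := (s ∩ t).indicator _)]
      exact (integral_congr_ae (h s t hs ht)).symm
    rw [integral_sub hai.integrableOn hbi.integrableOn, e1, e2, sub_self]
  -- Conditional expectation is self-adjoint: both sides equal the integral of `μ[g | m] * μ[a |
  -- m]`.
  have h2 : ∫ ω, g ω * b ω ∂μ = ∫ ω, (μ[g | m]) ω * a ω ∂μ := by
    rw [← integral_mul_condExp_of_stronglyMeasurable hm stronglyMeasurable_condExp hai (hag hci)]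
    have := integral_mul_condExp_of_stronglyMeasurable hm hbm hgi
      (by simpa [mul_comm] using hbg hgi)
    simpa [mul_comm] using this.symm
  rw [hind s _ hs']
  simp only [mul_sub, sub_mul] at h1 ⊢
  have h3 := integral_sub (hag hgi) (hbg hgi)
  have h4 := integral_sub (hag hgi) (hag hci)
  simp only [Pi.mul_apply] at h3 h4
  rw [h4, ← h2, ← h3]
  exact h1

/-- Condition on `M` first: the indicator of `t` pulls out, the factor left is already
`m`-measurable, and it pulls out when conditioning on `m`. -/
theorem condIndepGiven_of_condExp_eq {M : MeasurableSpace Ω} (hmM : m ≤ M) (hm₂M : m₂ ≤ M)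
    (hM : M ≤ mΩ) (hm₁ : m₁ ≤ mΩ)
    (h : ∀ s, MeasurableSet[m₁] s → μ[s.indicator (fun _ => (1 : ℝ)) | M] =ᵐ[μ]
      μ[s.indicator (fun _ => (1 : ℝ)) | m]) : CondIndepGiven m m₁ m₂ μ := by
  intro s t hs ht
  have hs' := hm₁ s hs
  have ht' := hM t (hm₂M t ht)
  set a : Ω → ℝ := s.indicator (fun _ => (1 : ℝ)) with ha
  set b : Ω → ℝ := t.indicator (fun _ => (1 : ℝ)) with hb
  have hai : Integrable a μ := (integrable_const 1).indicator hs'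
  have hbi : Integrable b μ := (integrable_const 1).indicator ht'
  have hbm : StronglyMeasurable[M] b := stronglyMeasurable_const.indicator (hm₂M t ht)
  have hbb : ∀ ω, ‖b ω‖ ≤ 1 := fun ω => by by_cases h : ω ∈ t <;> simp [hb, h]
  have hab : (s ∩ t).indicator (fun _ => (1 : ℝ)) = a * b := by
    ext ω
    by_cases h : ω ∈ t <;> by_cases h' : ω ∈ s <;> simp [h, h', ha, hb]
  have habi : ∀ {k : Ω → ℝ}, Integrable k μ → Integrable (k * b) μ := fun hk =>
    hk.mul_bdd hbi.aestronglyMeasurable (Filter.Eventually.of_forall hbb)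
  have h1 : μ[a * b | M] =ᵐ[μ] μ[a | m] * b := by
    refine (condExp_mul_of_stronglyMeasurable_right hbm (habi hai) hai).trans ?_
    filter_upwards [h s hs] with ω hω
    simp [ha, hω]
  rw [hab]
  calc μ[a * b | m] =ᵐ[μ] μ[μ[a * b | M] | m] := (condExp_condExp_of_le hmM hM).symm
    _ =ᵐ[μ] μ[μ[a | m] * b | m] := condExp_congr_ae h1
    _ =ᵐ[μ] μ[a | m] * μ[b | m] :=
      condExp_mul_of_stronglyMeasurable_left stronglyMeasurable_condExp (habi integrable_condExp)
        hbi

/-- Since `Y` is independent of `V`, the probability given `V` is `g (φ V)` with `g c = P((c, Y) ∈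
C)`. This is already a function of `φ V`. -/
theorem condExp_indicator_comap_of_indepFun {α β γ : Type*} [MeasurableSpace α]
    [StandardBorelSpace α] [Nonempty α] [MeasurableSpace β] [MeasurableSpace γ] {Y : Ω → α}
    {V : Ω → β} {φ : β → γ} (hY : Measurable Y) (hV : Measurable V) (hφ : Measurable φ)
    (h : IndepFun V Y μ) {C : Set (γ × α)} (hC : MeasurableSet C) :
    μ[((fun ω => (φ (V ω), Y ω)) ⁻¹' C).indicator (fun _ => (1 : ℝ)) |
        MeasurableSpace.comap V inferInstance] =ᵐ[μ]
      μ[((fun ω => (φ (V ω), Y ω)) ⁻¹' C).indicator (fun _ => (1 : ℝ)) |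
        MeasurableSpace.comap (φ ∘ V) inferInstance] := by
  set f : γ × α → ℝ := C.indicator (fun _ => (1 : ℝ)) with hf
  have hfm : StronglyMeasurable f := stronglyMeasurable_const.indicator hC
  set F : Ω → ℝ := ((fun ω => (φ (V ω), Y ω)) ⁻¹' C).indicator (fun _ => (1 : ℝ)) with hF
  set f' : β × α → ℝ := fun p => f (φ p.1, p.2) with hf'
  have hf'm : StronglyMeasurable f' := hfm.comp_measurable (by fun_prop)
  have hFf : F = fun ω => f' (V ω, Y ω) := by
    ext ω
    simp [hF, hf', hf, Set.indicator, Set.mem_preimage]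
    rfl
  have hFi : Integrable (fun ω => f' (V ω, Y ω)) μ := by
    rw [← hFf]
    exact (integrable_const 1).indicator ((by fun_prop : Measurable fun ω => (φ (V ω), Y ω)) hC)
  have hd : condDistrib Y V μ =ᵐ[μ.map V] Kernel.const β (μ.map Y) := by
    have : IsProbabilityMeasure (μ.map Y) := Measure.isProbabilityMeasure_map hY.aemeasurable
    refine condDistrib_ae_eq_of_measure_eq_compProd V hY.aemeasurable ?_
    rw [Measure.compProd_const]
    exact (indepFun_iff_map_prod_eq_prod_map_map hV.aemeasurable hY.aemeasurable).1 h
  have h1 := condExp_prod_ae_eq_integral_condDistrib hV hY.aemeasurable hf'm hFi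
  set g : γ → ℝ := fun c => ∫ y, f (c, y) ∂(μ.map Y) with hg
  have hgm : StronglyMeasurable g := by
    have : IsProbabilityMeasure (μ.map Y) := Measure.isProbabilityMeasure_map hY.aemeasurable
    exact hfm.integral_prod_right'
  have h2 : μ[F | MeasurableSpace.comap V inferInstance] =ᵐ[μ] fun ω => g (φ (V ω)) := by
    rw [hFf]
    refine h1.trans ?_
    filter_upwards [ae_of_ae_map hV.aemeasurable hd] with ω hω
    simp [hω, hg, hf']
  have hle : MeasurableSpace.comap (φ ∘ V) inferInstance ≤
      MeasurableSpace.comap V inferInstance := by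
    rw [← MeasurableSpace.comap_comp]
    exact MeasurableSpace.comap_mono hφ.comap_le
  have hgi : Integrable (fun ω => g (φ (V ω))) μ := (integrable_condExp).congr h2
  have h3 : StronglyMeasurable[MeasurableSpace.comap (φ ∘ V) inferInstance]
      (fun ω => g (φ (V ω))) :=
    hgm.comp_measurable (comap_measurable (φ ∘ V))
  have h4 : μ[F | MeasurableSpace.comap (φ ∘ V) inferInstance] =ᵐ[μ] fun ω => g (φ (V ω)) := by
    refine (condExp_condExp_of_le hle hV.comap_le).symm.trans ((condExp_congr_ae h2).trans ?_)
    rw [condExp_of_stronglyMeasurable (hφ.comp hV).comap_le h3 hgi]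
  exact h2.trans h4.symm

end CondExp

end CMSeq

namespace CMSeq

/-! ### Conditional independence and zeros of the precision matrix -/

section Gaussian

open Matrix

variable {n Ω : Type*} {x : n → Ω → ℝ}

/-- The σ-algebra generated by the variables with index in `S`. -/
@[reducible] def coordSigma (x : n → Ω → ℝ) (S : Set n) : MeasurableSpace Ω :=
  MeasurableSpace.comap (fun ω (p : S) => x p ω) inferInstance

theorem measurable_coordSigma {S : Set n} {p : n} (hp : p ∈ S) :
    Measurable[coordSigma x S] (x p) :=
  (measurable_pi_apply (⟨p, hp⟩ : S)).comp (comap_measurable fun ω (p : S) => x p ω)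

theorem coordSigma_le [mΩ : MeasurableSpace Ω] (hx : ∀ p, Measurable (x p)) (S : Set n) : coordSigma x S ≤ mΩ :=
  (measurable_pi_lambda (fun ω (p : S) => x p ω) fun p => hx p).comap_le

theorem coordSigma_mono {S T : Set n} (h : S ⊆ T) : coordSigma x S ≤ coordSigma x T := by
  refine Measurable.comap_le ?_
  exact @measurable_pi_lambda _ _ _ (coordSigma x T) _ _ fun p => measurable_coordSigma (h p.2)

variable [Fintype n] [mΩ : MeasurableSpace Ω] {μ : Measure Ω} [IsProbabilityMeasure μ]
  (hG : HasGaussianLaw (fun ω p => x p ω) μ)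

include hG in
theorem covariance_sum_mul_eq_mulVec {C : Matrix n n ℝ} (hC : ∀ p q, cov[x p, x q; μ] = C p q)
    (w : n → ℝ) (p : n) : cov[x p, fun ω => ∑ q, w q * x q ω; μ] = (C *ᵥ w) p := by
  rw [covariance_fun_sum_right (fun q => (hG.eval q).memLp_two.const_mul _) (hG.eval p).memLp_two]
  refine Finset.sum_congr rfl fun q _ => ?_
  rw [covariance_const_mul_right, hC, mul_comm]

include hG in
theorem indepFun_residual {C : Matrix n n ℝ} (hC : ∀ p q, cov[x p, x q; μ] = C p q) {κ : Type*}
    [Finite κ] {T : Set n} {w : κ → n → ℝ} (hw : ∀ k, ∀ p ∈ T, (C *ᵥ w k) p = 0) :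
    IndepFun (fun ω (p : T) => x p ω) (fun ω k => ∑ q, w k q * x q ω) μ := by
  have : Fintype κ := Fintype.ofFinite κ
  have : Fintype T := Fintype.ofFinite T
  refine HasGaussianLaw.indepFun_of_covariance_eval (X := fun (p : T) ω => x p ω)
    (Y := fun k ω => ∑ q, w k q * x q ω) ?_ fun p k => ?_
  · let L : (n → ℝ) →L[ℝ] (T → ℝ) × (κ → ℝ) := (ContinuousLinearMap.pi fun p : T =>
      ContinuousLinearMap.proj (R := ℝ) (φ := fun _ : n => ℝ) (p : n)).prod
      (ContinuousLinearMap.pi fun k => ∑ q, w k q •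
        ContinuousLinearMap.proj (R := ℝ) (φ := fun _ : n => ℝ) q)
    have hL : (fun ω => (fun p : T => x p ω, fun k => ∑ q, w k q * x q ω)) =
        fun ω => L fun p => x p ω := by
      ext ω k <;> simp [L]
    rw [hL]
    exact hG.map_fun L
  · rw [covariance_sum_mul_eq_mulVec hG hC, hw k p p.2]

include hG in
theorem condIndepGiven_of_precision_eq_zero (hx : ∀ p, Measurable (x p)) {A C : Matrix n n ℝ}
    (hC : ∀ p q, cov[x p, x q; μ] = C p q) (hCpos : C.PosDef) (hA : A.PosDef)
    (hAC : ∀ v, A *ᵥ (C *ᵥ v) = v) {S S₁ S₂ : Set n}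
    (hcov : ∀ p, p ∈ S ∨ p ∈ S₁ ∨ p ∈ S₂) (h₁ : Disjoint S₁ S) (h₁₂ : Disjoint S₁ S₂)
    (h₂ : Disjoint S₂ S) (hz : ∀ p ∈ S₂, ∀ q ∈ S₁, A p q = 0) :
    CondIndepGiven (coordSigma x S) (coordSigma x S₁) (coordSigma x S₂) μ := by
  classical
  choose w hw0 hw1 hwC using fun i : S₁ =>
    exists_residual_coeff hCpos (S := S) (Set.disjoint_left.1 h₁ i.2)
  have hindep := indepFun_residual hG hC (T := S₁ᶜ) (w := w) (by
    intro i p hp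
    rcases hcov p with h | h | h
    · exact hwC i p h
    · exact absurd h hp
    -- The only use of the zero block: residuals after regression on `S` are uncorrelated with `S₂`
    -- as well.
    · refine mulVec_residual_eq_zero hA hAC hcov hz (fun q hq => ?_) (hwC i) p h
      exact hw0 i q (Set.disjoint_left.1 h₂ hq) fun e => Set.disjoint_left.1 h₁₂ i.2 (e ▸ hq))
  have hS : S ⊆ S₁ᶜ := fun p hp hp' => Set.disjoint_left.1 h₁ hp' hp
  have hS₂ : S₂ ⊆ S₁ᶜ := fun p hp hp' => Set.disjoint_left.1 h₁₂ hp' hp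
  refine condIndepGiven_of_condExp_eq (M := coordSigma x S₁ᶜ) (coordSigma_mono hS)
    (coordSigma_mono hS₂) (coordSigma_le hx _) (coordSigma_le hx _) ?_
  rintro s ⟨B, hB, rfl⟩
  set V : Ω → ↥(S₁ᶜ) → ℝ := fun ω p => x p ω with hV
  set Y : Ω → S₁ → ℝ := fun ω k => ∑ q, w k q * x q ω with hY
  set φ : (↥(S₁ᶜ) → ℝ) → S → ℝ := fun v s => v ⟨s, hS s.2⟩ with hφ
  -- `h` rebuilds `x_{S₁}` from `x_S` and the residuals `Y`, so events of `x_{S₁}` see `V` only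
  -- through `φ V`.
  set h : (S → ℝ) × (S₁ → ℝ) → S₁ → ℝ := fun c i => c.2 i - ∑ s : S, w i s * c.1 s with hh
  have hhm : Measurable h := by fun_prop
  have hset : (fun ω (p : S₁) => x p ω) ⁻¹' B = (fun ω => (φ (V ω), Y ω)) ⁻¹' (h ⁻¹' B) := by
    rw [← Set.preimage_comp]
    congr 1
    ext ω i
    have hi : (i : n) ∉ S := Set.disjoint_left.1 h₁ i.2
    simp only [Function.comp_apply, hh, hY, hφ, hV]
    rw [← Fintype.sum_subtype_add_sum_subtype (· ∈ S),
      Finset.sum_eq_single (⟨i, hi⟩ : {p // p ∉ S})]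
    · simp [hw1]
    · rintro ⟨p, hp⟩ - hpj
      simp [hw0 i p hp fun h => hpj (Subtype.ext h)]
    · simp
  rw [hset]
  have hYm : Measurable Y := measurable_pi_lambda _ fun i =>
    Finset.measurable_fun_sum _ fun q _ => (hx q).const_mul _
  have hVm : Measurable V := measurable_pi_lambda _ fun p => hx p
  have hφm : Measurable φ := by fun_prop
  exact condExp_indicator_comap_of_indepFun hYm hVm hφm hindep (hhm hB)

include hG in
theorem precision_eq_zero_of_condIndepGiven (hx : ∀ p, Measurable (x p))
    (hmean : ∀ p, ∫ ω, x p ω ∂μ = 0) {A C : Matrix n n ℝ}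
    (hC : ∀ p q, cov[x p, x q; μ] = C p q) (hCpos : C.PosDef) (hA : A.PosDef)
    (hAC : ∀ v, A *ᵥ (C *ᵥ v) = v) {S S₁ S₂ : Set n}
    (hcov : ∀ p, p ∈ S ∨ p ∈ S₁ ∨ p ∈ S₂) (h₁ : Disjoint S₁ S) (h₁₂ : Disjoint S₁ S₂)
    (h₂ : Disjoint S₂ S)
    (h : CondIndepGiven (coordSigma x S) (coordSigma x S₁) (coordSigma x S₂) μ) :
    ∀ i ∈ S₁, ∀ j ∈ S₂, A i j = 0 := by
  classical
  have hex : ∀ j, ∃ w : n → ℝ, j ∈ S₂ → (∀ p, p ∉ S → p ≠ j → w p = 0) ∧ w j = 1 ∧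
      ∀ s ∈ S, (C *ᵥ w) s = 0 := by
    intro j
    by_cases hj : j ∈ S₂
    · obtain ⟨w, hw⟩ := exists_residual_coeff hCpos (S := S) (Set.disjoint_left.1 h₂ hj)
      exact ⟨w, fun _ => hw⟩
    · exact ⟨0, fun h => absurd h hj⟩
  choose w hw using hex
  intro i hi
  refine eq_zero_of_mulVec_residual hA hAC w (fun j hj => (hw j hj).2.1)
    (fun j hj p hp hpj => (hw j hj).1 p (Set.disjoint_left.1 h₂ hp) hpj) (fun j hj p hp => ?_)
    fun j hj => (hw j hj).1 i (Set.disjoint_left.1 h₁ hi)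
      fun e => Set.disjoint_left.1 h₁₂ hi (e ▸ hj)
  rcases hcov p with hpS | hpS | hpS
  · exact (hw j hj).2.2 p hpS
  swap
  · exact absurd hpS hp
  have hm := coordSigma_le hx S
  have hmem : ∀ q, MemLp (x q) 2 μ := fun q => (hG.eval q).memLp_two
  set u : Ω → ℝ := fun ω => ∑ q, w j q * x q ω with hu
  have humem : MemLp u 2 μ := memLp_finsetSum _ fun q _ => (hmem q).const_mul _
  have humean : ∫ ω, u ω ∂μ = 0 := by
    rw [hu, integral_finsetSum _ fun q _ => ((hmem q).integrable one_le_two).const_mul _]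
    simp [integral_const_mul, hmean]
  have hindep := indepFun_residual hG hC (T := S) (w := fun _ : Unit => w j)
    fun _ p hp => (hw j hj).2.2 p hp
  have hum : Measurable fun ω (_ : Unit) => u ω := measurable_pi_lambda _ fun _ =>
    Finset.measurable_fun_sum _ fun q _ => (hx q).const_mul _
  -- The residual `u` is centred and independent of `x_S`, so `x j - u` is the conditional
  -- expectation of `x j`.
  have hu0 : μ[u | coordSigma x S] =ᵐ[μ] fun _ => 0 := by
    have := condExp_indep_eq (f := u) hum.comap_le hm
      ((measurable_pi_apply ()).comp
        (comap_measurable fun ω (_ : Unit) => u ω)).stronglyMeasurable hindep.symm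
    rwa [humean] at this
  have hb : StronglyMeasurable[coordSigma x S] (x j - u) := by
    have : x j - u = fun ω => -∑ s : S, w j s * x s ω := by
      ext ω
      simp only [Pi.sub_apply, hu]
      rw [← Fintype.sum_subtype_add_sum_subtype (· ∈ S),
        Finset.sum_eq_single (⟨j, Set.disjoint_left.1 h₂ hj⟩ : {p // p ∉ S})]
      · simp [(hw j hj).2.1]
      · rintro ⟨p, hp⟩ - hpj
        simp [(hw j hj).1 p hp fun h => hpj (Subtype.ext h)]
      · simp
    rw [this]
    exact (Measurable.neg (Finset.measurable_fun_sum _ fun s _ =>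
      (measurable_coordSigma s.2).const_mul _)).stronglyMeasurable
  have hcond : μ[x j | coordSigma x S] =ᵐ[μ] x j - u := by
    have h1 := condExp_sub ((hmem j).integrable one_le_two) (humem.integrable one_le_two)
      (coordSigma x S)
    rw [condExp_of_stronglyMeasurable hm hb
      (((hmem j).sub humem).integrable one_le_two)] at h1
    filter_upwards [h1, hu0] with ω h1 h2
    rw [h1]
    simp [h2]
  -- Conditional independence makes `x p` orthogonal to `x j - μ[x j | x_S] = u`, that is, `(C w j)
  -- p = 0`.
  have key := h.integral_mul_condExp hm (coordSigma_le hx _) (coordSigma_le hx _)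
    (measurable_coordSigma hpS).stronglyMeasurable (measurable_coordSigma hj).stronglyMeasurable
    (hmem p) (hmem j)
  rw [← covariance_sum_mul_eq_mulVec hG hC, covariance_eq_sub (hmem p) humem, hmean p, zero_mul,
    sub_zero, ← key]
  refine integral_congr_ae ?_
  filter_upwards [hcond] with ω hω
  simp [hω, hu]

end Gaussian

end CMSeq

namespace CMSeq

/-! ### The model as an invertible linear system -/

section Model

open Matrix

variable {N d : ℕ}

theorem ite_zero_mulVec {m n : Type*} [Fintype n] (c : Prop) [Decidable c] (A : Matrix m n ℝ)
    (v : n → ℝ) : (if c then A else 0) *ᵥ v = if c then A *ᵥ v else 0 := by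
  split_ifs <;> simp

theorem comp_mulVec_apply {ι κ : Type*} [Fintype ι] [Fintype κ] (M : Matrix ι ι (Matrix κ κ ℝ))
    (v : ι × κ → ℝ) (k : ι) (i : κ) :
    (Matrix.comp _ _ _ _ _ M *ᵥ v) (k, i) = (∑ l, M k l *ᵥ fun j => v (l, j)) i := by
  simp [mulVec, dotProduct, Fintype.sum_prod_type, Finset.sum_apply]

theorem blockDiag_posDef {Γ : Fin (N + 1) → Matrix (Fin d) (Fin d) ℝ} (hΓ : ∀ k, (Γ k).PosDef) :
    (blockDiag Γ).PosDef := by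
  refine PosDef.of_dotProduct_mulVec_pos ?_ fun v hv => ?_
  · ext ⟨k, i⟩ ⟨l, j⟩
    by_cases h : l = k
    · subst h
      simpa [blockDiag] using congrFun₂ (hΓ l).isHermitian i j
    · simp [blockDiag, diagonal_apply_ne _ h, diagonal_apply_ne _ (Ne.symm h)]
  · have h1 : star v ⬝ᵥ blockDiag Γ *ᵥ v =
        ∑ k, star (fun i => v (k, i)) ⬝ᵥ Γ k *ᵥ fun i => v (k, i) := by
      simp only [dotProduct, Fintype.sum_prod_type]
      refine Finset.sum_congr rfl fun k _ => Finset.sum_congr rfl fun i _ => ?_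
      congr 1
      rw [blockDiag, comp_mulVec_apply, Finset.sum_eq_single k]
      · simp
      · intro l _ hl
        simp [diagonal_apply_ne _ hl.symm]
      · simp
    rw [h1]
    obtain ⟨⟨k, i⟩, hki⟩ := Function.ne_iff.1 hv
    refine Finset.sum_pos' (fun l _ => (hΓ l).posSemidef.dotProduct_mulVec_nonneg _)
      ⟨k, Finset.mem_univ _, (hΓ k).dotProduct_mulVec_pos fun h => hki (congrFun h i)⟩

variable (b : ForwardModel) (G : Fin (N + 1) → Fin (N + 1) → Matrix (Fin d) (Fin d) ℝ)

/-- One formula for the dynamic rows of all three models. For `c = 0` and row `1` the last two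
indicators coincide and produce the coefficient `-2`. -/
theorem modelBlocks_succ {j : Fin N} (hj : j.succ ≠ b.c) (l : Fin (N + 1)) :
    modelBlocks b G j.succ l = (if l = j.succ then 1 else 0) +
      (if l = j.castSucc then -G j.succ l else 0) + (if l = b.c then -G j.succ l else 0) := by
  have h1 : j.castSucc ≠ j.succ := (Fin.castSucc_lt_succ (i := j)).ne
  have h2 : j.castSucc ≠ Fin.last N := (Fin.castSucc_lt_last j).ne
  have h0 : j.succ ≠ 0 := Fin.succ_ne_zero j
  have hv : ∀ l : Fin (N + 1), l.val + 1 = j.succ.val ↔ l = j.castSucc := by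
    intro l; simp [Fin.ext_iff]
  have hv1 : j.succ.val = 1 ↔ j.castSucc = 0 := by simp [Fin.ext_iff]
  cases b
  · replace hj : j.succ ≠ Fin.last N := hj
    simp only [modelBlocks, of_apply, hv, h0, hj, if_false, ForwardModel.c]
    by_cases e1 : l = j.succ
    · subst e1; simp [h1.symm, hj]
    · by_cases e2 : l = j.castSucc
      · subst e2; simp [h1, h1.symm, h2]
      · by_cases e3 : l = Fin.last N <;> simp [e1, e2, e3, Ne.symm e1, hj, Ne.symm hj, Ne.symm h2]
  · replace hj : j.succ ≠ Fin.last N := hj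
    simp only [modelBlocks, of_apply, hv, hj, if_false, ForwardModel.c]
    by_cases e1 : l = j.succ
    · subst e1; simp [h1.symm, hj]
    · by_cases e2 : l = j.castSucc
      · subst e2; simp [h1, h1.symm, h2]
      · by_cases e3 : l = Fin.last N <;> simp [e1, e2, e3, Ne.symm e1, hj, Ne.symm hj, Ne.symm h2]
  · simp only [modelBlocks, of_apply, hv, hv1, ForwardModel.c]
    by_cases e1 : l = j.succ
    · subst e1; simp [h1.symm, h0]
    · by_cases e2 : l = j.castSucc
      · subst e2
        by_cases e3 : j.castSucc = 0
        · simp [e3, two_smul, h0, Ne.symm h0]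
        · simp [h1.symm, h1, e3]
      · by_cases e3 : l = 0
        · subst e3; simp [e1, h0, e2, Ne.symm e2]
        · simp [e1, e2, e3, Ne.symm e1]

theorem sum_modelBlocks_succ {j : Fin N} (hj : j.succ ≠ b.c) (y : Fin (N + 1) → Fin d → ℝ) :
    ∑ l, modelBlocks b G j.succ l *ᵥ y l =
      y j.succ - G j.succ j.castSucc *ᵥ y j.castSucc - G j.succ b.c *ᵥ y b.c := by
  simp only [modelBlocks_succ b G hj, add_mulVec, Finset.sum_add_distrib, ite_zero_mulVec,
    Finset.sum_ite_eq', Finset.mem_univ, if_true, one_mulVec, neg_mulVec, sub_eq_add_neg]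

theorem modelMatrix_mulVec_eq_iff (hN : 1 ≤ N) {Ω : Type*} (X e : Fin (N + 1) → Ω → Fin d → ℝ)
    (ω : Ω) :
    (modelMatrix b G *ᵥ (fun p => X p.1 ω p.2) = fun p => e p.1 ω p.2) ↔
      (∀ j : Fin N, j.succ ≠ b.c → X j.succ ω = (G j.succ j.castSucc).mulVec (X j.castSucc ω)
        + (G j.succ b.c).mulVec (X b.c ω) + e j.succ ω) ∧ b.Boundary G X e ω := by
  have hlast : Fin.last N ≠ 0 := by simp [Fin.ext_iff]; omega
  have h1 : (modelMatrix b G *ᵥ (fun p => X p.1 ω p.2) = fun p => e p.1 ω p.2) ↔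
      ∀ k, ∑ l, modelBlocks b G k l *ᵥ X l ω = e k ω := by
    constructor
    · intro h k
      ext i
      rw [← congrFun h (k, i), modelMatrix, comp_mulVec_apply]
    · intro h
      ext ⟨k, i⟩
      rw [modelMatrix, comp_mulVec_apply, ← h k]
  have hs : ∀ u v w z : Fin d → ℝ, u - v - w = z ↔ u = v + w + z := fun u v w z => by
    rw [sub_sub, sub_eq_iff_eq_add, add_comm]
  have hs' : ∀ u v z : Fin d → ℝ, u - v = z ↔ u = v + z := fun u v z => by
    rw [sub_eq_iff_eq_add, add_comm]
  rw [h1]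
  have hsucc : ∀ j : Fin N, j.succ ≠ b.c → (∑ l, modelBlocks b G j.succ l *ᵥ X l ω = e j.succ ω ↔
      X j.succ ω = (G j.succ j.castSucc).mulVec (X j.castSucc ω)
        + (G j.succ b.c).mulVec (X b.c ω) + e j.succ ω) := fun j hj => by
    rw [sum_modelBlocks_succ b G hj fun l => X l ω, hs]
  -- Every row is dynamic, row `0` or row `c`; the last two encode the boundary condition and
  -- coincide when `c = 0`.
  have hall : (∀ k, ∑ l, modelBlocks b G k l *ᵥ X l ω = e k ω) ↔
      (∀ j : Fin N, j.succ ≠ b.c → ∑ l, modelBlocks b G j.succ l *ᵥ X l ω = e j.succ ω) ∧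
      ∑ l, modelBlocks b G 0 l *ᵥ X l ω = e 0 ω ∧
      ∑ l, modelBlocks b G b.c l *ᵥ X l ω = e b.c ω := by
    refine ⟨fun h => ⟨fun j _ => h _, h _, h _⟩, fun ⟨ha, h0, hc⟩ k => ?_⟩
    refine Fin.cases h0 (fun j => ?_) k
    by_cases hj : j.succ = b.c
    · rw [hj]; exact hc
    · exact ha j hj
  rw [hall]
  refine and_congr (forall₂_congr hsucc) ?_
  cases b
  · have r0 : ∀ l, modelBlocks .lastBC1 G 0 l = if l = 0 then 1 else 0 := fun l => by
      simp [modelBlocks, eq_comm]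
    have rl : ∀ l, modelBlocks .lastBC1 G (Fin.last N) l = (if l = Fin.last N then 1 else 0) +
        if l = 0 then -G (Fin.last N) l else 0 := fun l => by
      by_cases e1 : l = Fin.last N
      · simp [modelBlocks, e1, hlast]
      · simp [modelBlocks, e1, Ne.symm e1, hlast]
    simp only [ForwardModel.c, ForwardModel.Boundary, r0, rl, add_mulVec, Finset.sum_add_distrib,
      ite_zero_mulVec, Finset.sum_ite_eq', Finset.mem_univ, if_true, one_mulVec,
      neg_mulVec, ← sub_eq_add_neg, hs']
  · have r0 : ∀ l, modelBlocks .lastBC2 G (Fin.last N) l = if l = Fin.last N then 1 else 0 :=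
      fun l => by
        simp [modelBlocks, eq_comm]
    have rl : ∀ l, modelBlocks .lastBC2 G 0 l = (if l = 0 then 1 else 0) +
        if l = Fin.last N then -G 0 l else 0 := fun l => by
      by_cases e1 : l = 0
      · simp [modelBlocks, e1, Ne.symm hlast]
      · simp [modelBlocks, e1, Ne.symm e1, Ne.symm hlast]
    simp only [ForwardModel.c, ForwardModel.Boundary, r0, rl, add_mulVec, Finset.sum_add_distrib,
      ite_zero_mulVec, Finset.sum_ite_eq', Finset.mem_univ, if_true, one_mulVec,
      neg_mulVec, ← sub_eq_add_neg, hs']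
    exact and_comm
  · have r0 : ∀ l, modelBlocks .first G 0 l = if l = 0 then 1 else 0 := fun l => by
      by_cases e1 : l = 0
      · simp [modelBlocks, e1]
      · simp [modelBlocks, e1, Ne.symm e1]
    simp only [ForwardModel.c, ForwardModel.Boundary, r0, and_self, ite_zero_mulVec,
      Finset.sum_ite_eq', Finset.mem_univ, if_true, one_mulVec]

/-- A kernel vector solves the model with zero noise: the boundary condition kills the entries at
`0` and `c`, and the recursion kills the rest. -/
theorem isUnit_modelMatrix (hN : 1 ≤ N) : IsUnit (modelMatrix b G) := by
  rw [← mulVec_injective_iff_isUnit]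
  refine (injective_iff_map_eq_zero (modelMatrix b G).mulVecLin).2 fun v hv => ?_
  obtain ⟨hdyn, hbd⟩ := (modelMatrix_mulVec_eq_iff b G hN (fun k (_ : Unit) i => v (k, i))
    (fun _ _ _ => 0) ()).1 hv
  set y : Fin (N + 1) → Fin d → ℝ := fun k i => v (k, i) with hy
  have hz : (fun _ : Fin d => (0 : ℝ)) = 0 := rfl
  have h0c : y 0 = 0 ∧ y b.c = 0 := by
    cases b
    · obtain ⟨h0, hl⟩ := hbd
      refine ⟨h0, hl.trans ?_⟩
      simp only [h0, hz, mulVec_zero, add_zero]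
    · obtain ⟨hl, h0⟩ := hbd
      refine ⟨h0.trans ?_, hl⟩
      simp only [hl, hz, mulVec_zero, add_zero]
    · exact ⟨hbd, hbd⟩
  have hall : ∀ k, y k = 0 := by
    intro k
    induction k using Fin.induction with
    | zero => exact h0c.1
    | succ j ih =>
      by_cases hj : j.succ = b.c
      · rw [hj]; exact h0c.2
      · refine (hdyn j hj).trans ?_
        change _ *ᵥ y j.castSucc + _ *ᵥ y b.c + _ = _
        rw [ih, h0c.2, hz, mulVec_zero, mulVec_zero, add_zero, add_zero]
  ext ⟨k, i⟩
  exact congrFun (hall k) i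

end Model

end CMSeq

namespace CMSeq

/-! ### The precision matrix of the model, and the two characterizations -/

section Covariance

open Matrix

variable {N d : ℕ} {b : ForwardModel} {G : Fin (N + 1) → Fin (N + 1) → Matrix (Fin d) (Fin d) ℝ}
  {Γ : Fin (N + 1) → Matrix (Fin d) (Fin d) ℝ}

theorem matrixA_posDef (hN : 1 ≤ N) (hΓ : ∀ k, (Γ k).PosDef) : (matrixA b G Γ).PosDef := by
  have := (blockDiag_posDef hΓ).inv.conjTranspose_mul_mul_same
    (mulVec_injective_iff_isUnit.2 (isUnit_modelMatrix b G hN))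
  rwa [conjTranspose_eq_transpose_of_trivial] at this

variable {Ω : Type*} [MeasurableSpace Ω] {μ : Measure Ω} {X e : Fin (N + 1) → Ω → Fin d → ℝ}

theorem HasGaussianLaw.uncurry (h : HasGaussianLaw (fun ω k => X k ω) μ) :
    HasGaussianLaw (fun ω (p : Fin (N + 1) × Fin d) => X p.1 ω p.2) μ := by
  let L : (Fin (N + 1) → Fin d → ℝ) →ₗ[ℝ] (Fin (N + 1) × Fin d → ℝ) :=
    { toFun := fun y p => y p.1 p.2
      map_add' := fun _ _ => rfl
      map_smul' := fun _ _ => rfl }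
  exact h.map_fun (LinearMap.toContinuousLinearMap L)

theorem covariance_congr_ae {u u' v v' : Ω → ℝ} (hu : u =ᵐ[μ] u') (hv : v =ᵐ[μ] v') :
    cov[u, v; μ] = cov[u', v'; μ] := by
  rw [covariance, covariance, integral_congr_ae hu, integral_congr_ae hv]
  refine integral_congr_ae ?_
  filter_upwards [hu, hv] with ω h1 h2
  rw [h1, h2]

theorem covMatrix_mulVec [IsProbabilityMeasure μ]
    (B : Matrix (Fin (N + 1) × Fin d) (Fin (N + 1) × Fin d) ℝ)
    (he : HasGaussianLaw (fun ω k => e k ω) μ)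
    (hX : ∀ᵐ ω ∂μ, (fun p : Fin (N + 1) × Fin d => X p.1 ω p.2) = B *ᵥ fun p => e p.1 ω p.2) :
    covMatrix X μ = B * covMatrix e μ * Bᵀ := by
  have hmem : ∀ p : Fin (N + 1) × Fin d, MemLp (fun ω => e p.1 ω p.2) 2 μ := fun p =>
    ((HasGaussianLaw.uncurry he).eval p).memLp_two
  have hXp : ∀ p : Fin (N + 1) × Fin d, (fun ω => X p.1 ω p.2) =ᵐ[μ]
      fun ω => ∑ q, B p q * e q.1 ω q.2 := by
    intro p
    filter_upwards [hX] with ω hω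
    exact congrFun hω p
  ext p q
  simp only [covMatrix, of_apply]
  rw [covariance_congr_ae (hXp p) (hXp q), covariance_fun_sum_fun_sum
    (fun r => (hmem r).const_mul _) fun r => (hmem r).const_mul _]
  simp only [mul_apply, transpose_apply, of_apply, Finset.sum_mul]
  rw [Finset.sum_comm]
  refine Finset.sum_congr rfl fun r _ => Finset.sum_congr rfl fun s _ => ?_
  rw [covariance_const_mul_left, covariance_const_mul_right]
  ring

theorem Governs.ae_eq_mulVec (hN : 1 ≤ N) (h : Governs b G Γ X e μ) :
    ∀ᵐ ω ∂μ, (fun p : Fin (N + 1) × Fin d => X p.1 ω p.2) =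
      (modelMatrix b G)⁻¹ *ᵥ fun p => e p.1 ω p.2 := by
  filter_upwards [h.dynamics, h.boundary] with ω h1 h2
  rw [← (modelMatrix_mulVec_eq_iff b G hN X e ω).2 ⟨h1, h2⟩, mulVec_mulVec, nonsing_inv_mul _
    ((isUnit_iff_isUnit_det _).1 (isUnit_modelMatrix b G hN)), one_mulVec]

theorem Governs.matrixA_mul_covMatrix [IsProbabilityMeasure μ] (hN : 1 ≤ N)
    (hΓ : ∀ k, (Γ k).PosDef) (h : Governs b G Γ X e μ) :
    matrixA b G Γ * covMatrix X μ = 1 := by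
  have hM := (isUnit_iff_isUnit_det _).1 (isUnit_modelMatrix b G hN)
  have hD := (isUnit_iff_isUnit_det _).1 (blockDiag_posDef hΓ).isUnit
  rw [covMatrix_mulVec _ h.noise.gaussian (h.ae_eq_mulVec hN), h.noise.cov_eq, matrixA]
  calc (modelMatrix b G)ᵀ * (blockDiag Γ)⁻¹ * modelMatrix b G *
        ((modelMatrix b G)⁻¹ * blockDiag Γ * ((modelMatrix b G)⁻¹)ᵀ)
      = (modelMatrix b G)ᵀ * ((blockDiag Γ)⁻¹ * (modelMatrix b G * (modelMatrix b G)⁻¹) *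
        blockDiag Γ) * ((modelMatrix b G)⁻¹)ᵀ := by simp only [Matrix.mul_assoc]
    _ = ((modelMatrix b G)⁻¹ * modelMatrix b G)ᵀ := by
      rw [mul_nonsing_inv _ hM, Matrix.mul_one, nonsing_inv_mul _ hD, Matrix.mul_one,
        transpose_mul]
    _ = 1 := by rw [nonsing_inv_mul _ hM, transpose_one]

theorem Governs.isZMNG [IsProbabilityMeasure μ] (hN : 1 ≤ N) (hΓ : ∀ k, (Γ k).PosDef)
    (h : Governs b G Γ X e μ) : IsZMNG X μ where
  measurable := h.measurable
  gaussian := by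
    let L : (Fin (N + 1) → Fin d → ℝ) →ₗ[ℝ] (Fin (N + 1) → Fin d → ℝ) :=
      { toFun := fun y k i => ((modelMatrix b G)⁻¹ *ᵥ fun p => y p.1 p.2) (k, i)
        map_add' := fun y z => by
          ext k i
          exact congrFun (mulVec_add _ (fun p : _ × _ => y p.1 p.2) fun p => z p.1 p.2) (k, i)
        map_smul' := fun c y => by
          ext k i
          exact congrFun (mulVec_smul _ c fun p : _ × _ => y p.1 p.2) (k, i) }
    refine (h.noise.gaussian.map_fun (LinearMap.toContinuousLinearMap L)).congr ?_
    filter_upwards [h.ae_eq_mulVec hN] with ω hω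
    ext k i
    exact (congrFun hω (k, i)).symm
  mean_zero := by
    intro k i
    have : (fun ω => X k ω i) =ᵐ[μ]
        fun ω => ∑ q : _ × _, (modelMatrix b G)⁻¹ (k, i) q * e q.1 ω q.2 := by
      filter_upwards [h.ae_eq_mulVec hN] with ω hω
      exact congrFun hω (k, i)
    rw [integral_congr_ae this, integral_finsetSum _ fun q _ =>
      ((HasGaussianLaw.uncurry h.noise.gaussian).eval q).integrable.const_mul _]
    simp [integral_const_mul, h.noise.mean_zero]
  nonsingular := IsUnit.of_mul_eq_one_right _ (h.matrixA_mul_covMatrix hN hΓ)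

variable (b G) in
theorem exists_governs (hN : 1 ≤ N) (hΓ : ∀ k, (Γ k).PosDef) :
    ∃ (Ω : Type) (_ : MeasurableSpace Ω) (μ : Measure Ω) (_ : IsProbabilityMeasure μ)
      (X e : Fin (N + 1) → Ω → Fin d → ℝ), Governs b G Γ X e μ := by
  -- The coordinates of a Gaussian vector with covariance `blockDiag Γ` serve as noise, and `X = 𝒢⁻¹
  -- e` holds pointwise.
  refine ⟨EuclideanSpace ℝ (Fin (N + 1) × Fin d), inferInstance,
    multivariateGaussian 0 (blockDiag Γ), inferInstance,
    fun k ω i => ((modelMatrix b G)⁻¹ *ᵥ fun p => ω p) (k, i), fun k ω i => ω (k, i), ?_⟩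
  have hsol := fun ω : EuclideanSpace ℝ (Fin (N + 1) × Fin d) =>
    (modelMatrix_mulVec_eq_iff b G hN
      (fun k ω i => ((modelMatrix b G)⁻¹ *ᵥ fun p => ω p) (k, i)) (fun k ω i => ω (k, i)) ω).1 (by
        change modelMatrix b G *ᵥ ((modelMatrix b G)⁻¹ *ᵥ fun p => ω p) = _
        rw [mulVec_mulVec, mul_nonsing_inv _
          ((isUnit_iff_isUnit_det _).1 (isUnit_modelMatrix b G hN)), one_mulVec])
  refine ⟨fun k => ?_, ⟨⟨fun k => ?_, ?_, fun k i => ?_⟩, ?_⟩,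
    Filter.Eventually.of_forall fun ω => (hsol ω).1,
    Filter.Eventually.of_forall fun ω => (hsol ω).2⟩
  · refine measurable_pi_lambda _ fun i => Finset.measurable_fun_sum _ fun q _ => ?_
    fun_prop
  · fun_prop
  · let L : EuclideanSpace ℝ (Fin (N + 1) × Fin d) →ₗ[ℝ] (Fin (N + 1) → Fin d → ℝ) :=
      { toFun := fun y k i => y (k, i)
        map_add' := fun _ _ => rfl
        map_smul' := fun _ _ => rfl }
    exact IsGaussian.hasGaussianLaw_id.map_fun (LinearMap.toContinuousLinearMap L)
  · have h1 := ContinuousLinearMap.integral_comp_comm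
      (EuclideanSpace.proj (k, i) : EuclideanSpace ℝ (Fin (N + 1) × Fin d) →L[ℝ] ℝ)
      (IsGaussian.integrable_id (μ := multivariateGaussian 0 (blockDiag Γ)))
    simpa using h1
  · ext p q
    exact covariance_eval_multivariateGaussian (blockDiag_posDef hΓ).posSemidef p q

theorem sigmaOf_eq_coordSigma {Ω : Type*} (X : Fin (N + 1) → Ω → Fin d → ℝ) (S : Set (Fin (N + 1))) :
    sigmaOf X S = coordSigma (fun (p : Fin (N + 1) × Fin d) ω => X p.1 ω p.2) {p | p.1 ∈ S} := by
  refine le_antisymm (iSup₂_le fun k hk => Measurable.comap_le ?_) (Measurable.comap_le ?_)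
  · exact @measurable_pi_lambda _ _ _ (_) _ _ fun i => measurable_coordSigma
      (x := fun (p : Fin (N + 1) × Fin d) ω => X p.1 ω p.2) (p := (k, i)) hk
  · refine @measurable_pi_lambda _ _ _ (_) _ _ fun p => ?_
    refine (measurable_pi_apply p.1.2).comp ?_
    exact Measurable.mono (comap_measurable (X p.1.1)) (le_iSup₂_of_le p.1.1 p.2 le_rfl) le_rfl

/-- Block form of the correspondence between conditional independence and zeros of the precision
matrix. -/
theorem Governs.condIndepGiven_iff [IsProbabilityMeasure μ] (hN : 1 ≤ N)
    (hΓ : ∀ k, (Γ k).PosDef) (h : Governs b G Γ X e μ) {S S₁ S₂ : Set (Fin (N + 1))}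
    (hcov : ∀ k, k ∈ S ∨ k ∈ S₁ ∨ k ∈ S₂) (h₁ : Disjoint S₁ S) (h₁₂ : Disjoint S₁ S₂)
    (h₂ : Disjoint S₂ S) :
    CondIndepGiven (sigmaOf X S) (sigmaOf X S₁) (sigmaOf X S₂) μ ↔
      ∀ k ∈ S₁, ∀ l ∈ S₂, ∀ i j, matrixA b G Γ (k, i) (l, j) = 0 := by
  have hZ := h.isZMNG hN hΓ
  have hA := matrixA_posDef (b := b) (G := G) hN hΓ
  have hAC := h.matrixA_mul_covMatrix hN hΓ
  have hCpos : (covMatrix X μ).PosDef := by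
    rw [← inv_eq_right_inv hAC]
    exact hA.inv
  have hACv : ∀ v, matrixA b G Γ *ᵥ (covMatrix X μ *ᵥ v) = v := fun v => by
    rw [mulVec_mulVec, hAC, one_mulVec]
  have hdisj : ∀ {T U : Set (Fin (N + 1))}, Disjoint T U →
      Disjoint {p : Fin (N + 1) × Fin d | p.1 ∈ T} {p | p.1 ∈ U} := fun hTU =>
    Set.disjoint_left.2 fun _ hp hp' => Set.disjoint_left.1 hTU hp hp'
  have hm : ∀ p : Fin (N + 1) × Fin d, Measurable fun ω => X p.1 ω p.2 := fun p =>
    (measurable_pi_apply p.2).comp (h.measurable p.1)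
  simp only [sigmaOf_eq_coordSigma]
  constructor
  · intro hci k hk l hl i j
    exact precision_eq_zero_of_condIndepGiven (HasGaussianLaw.uncurry hZ.gaussian) hm
      (fun p => hZ.mean_zero p.1 p.2) (fun _ _ => rfl) hCpos hA hACv (fun p => hcov p.1)
      (hdisj h₁) (hdisj h₁₂) (hdisj h₂) hci (k, i) hk (l, j) hl
  · intro hz
    refine condIndepGiven_of_precision_eq_zero (HasGaussianLaw.uncurry hZ.gaussian) hm
      (fun _ _ => rfl) hCpos hA hACv (fun p => hcov p.1) (hdisj h₁) (hdisj h₁₂) (hdisj h₂) ?_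
    intro p hp q hq
    rw [← hA.isHermitian.apply]
    simpa using hz q.1 hq p.1 hp q.2 p.2

theorem matrixA_isSymm (hN : 1 ≤ N) (hΓ : ∀ k, (Γ k).PosDef) : (matrixA b G Γ).IsSymm := by
  have := (matrixA_posDef (b := b) (G := G) hN hΓ).isHermitian
  rwa [IsHermitian, conjTranspose_eq_transpose_of_trivial] at this

theorem Governs.isMarkov_iff [IsProbabilityMeasure μ] (hN : 1 ≤ N) (hΓ : ∀ k, (Γ k).PosDef)
    (h : Governs b G Γ X e μ) : IsMarkov X μ ↔ IsTridiagonal (matrixA b G Γ) := by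
  have key : ∀ k : Fin (N + 1), CondIndepGiven (sigmaOf X {k}) (sigmaOf X {i | i < k})
      (sigmaOf X {i | k < i}) μ ↔
      ∀ r, r < k → ∀ s, k < s → ∀ i j, matrixA b G Γ (r, i) (s, j) = 0 := by
    intro k
    refine h.condIndepGiven_iff hN hΓ (fun r => ?_) ?_ ?_ ?_
    · rcases lt_trichotomy r k with h | h | h <;> simp [h]
    all_goals
      refine Set.disjoint_left.2 fun r hr hr' => ?_
      simp only [Set.mem_ofPred_eq, Set.mem_singleton_iff] at hr hr'
      omega
  have hsymm := matrixA_isSymm (b := b) (G := G) hN hΓ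
  simp only [IsMarkov, key, IsTridiagonal, hsymm, true_and]
  constructor
  · rintro H k l (hkl | hkl) i j
    -- The time `k + 1` lies strictly between `k` and `l`, so it separates them.
    · exact H ⟨k.val + 1, by omega⟩ k (by simp [Fin.lt_def]) l (by simpa [Fin.lt_def] using hkl) i j
    · rw [hsymm.apply]
      exact H ⟨l.val + 1, by omega⟩ l (by simp [Fin.lt_def]) k (by simpa [Fin.lt_def] using hkl) j i
  · intro H k r hr s hs i j
    exact H r s (Or.inl (by omega)) i j

theorem Governs.isReciprocal_iff [IsProbabilityMeasure μ] (hN : 1 ≤ N) (hΓ : ∀ k, (Γ k).PosDef)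
    (h : Governs b G Γ X e μ) : IsReciprocal X μ ↔ IsCyclicTridiagonal (matrixA b G Γ) := by
  have key : ∀ k₁ k₂ : Fin (N + 1), k₁ < k₂ → (CondIndepGiven (sigmaOf X {k₁, k₂})
      (sigmaOf X {i | k₁ < i ∧ i < k₂}) (sigmaOf X {i | i < k₁ ∨ k₂ < i}) μ ↔
      ∀ r, (k₁ < r ∧ r < k₂) → ∀ s, (s < k₁ ∨ k₂ < s) →
        ∀ i j, matrixA b G Γ (r, i) (s, j) = 0) := by
    intro k₁ k₂ hk
    refine h.condIndepGiven_iff hN hΓ (fun r => ?_) ?_ ?_ ?_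
    · simp only [Set.mem_insert_iff, Set.mem_singleton_iff, Set.mem_ofPred_eq]
      omega
    all_goals
      refine Set.disjoint_left.2 fun r hr hr' => ?_
      simp only [Set.mem_insert_iff, Set.mem_ofPred_eq, Set.mem_singleton_iff] at hr hr'
      omega
  have hsymm := matrixA_isSymm (b := b) (G := G) hN hΓ
  simp only [IsReciprocal, IsCyclicTridiagonal, hsymm, true_and]
  constructor
  · intro H
    -- An interior time `k` is isolated by its neighbours `k - 1` and `k + 1`.
    have inner : ∀ k l : Fin (N + 1), (k.val + 1 < l.val ∨ l.val + 1 < k.val) → k ≠ 0 →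
        k ≠ Fin.last N → ∀ i j, matrixA b G Γ (k, i) (l, j) = 0 := by
      intro k l hkl h0 hl i j
      have h0' : k.val ≠ 0 := fun h => h0 (Fin.ext h)
      have hl' : k.val ≠ N := fun h => hl (Fin.ext h)
      have hlt : (⟨k.val - 1, by omega⟩ : Fin (N + 1)) < ⟨k.val + 1, by omega⟩ := by
        simp only [Fin.lt_def]; omega
      refine (key _ _ hlt).1 (H _ _ hlt) k ?_ l ?_ i j
      · simp only [Fin.lt_def]; omega
      · simp only [Fin.lt_def]; omega
    intro k l hkl h1 h2 i j
    by_cases hk : k ≠ 0 ∧ k ≠ Fin.last N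
    · exact inner k l hkl hk.1 hk.2 i j
    -- If `k` is an endpoint, `l` is interior because the corner pairs are excluded; symmetry swaps
    -- their roles.
    · rw [hsymm.apply]
      simp only [Fin.ext_iff, Fin.val_zero, Fin.val_last, ne_eq] at h1 h2 hk
      refine inner l k hkl.symm ?_ ?_ j i <;>
        · simp only [ne_eq, Fin.ext_iff, Fin.val_zero, Fin.val_last]
          omega
  · intro H k₁ k₂ hk
    refine (key k₁ k₂ hk).2 fun r hr s hs i j => ?_
    have := k₂.isLt
    -- Either `k₁` or `k₂` lies strictly between `r` and `s`, and `r` is interior, so this is no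
    -- corner block.
    refine H r s ?_ ?_ ?_ i j
    · omega
    all_goals
      rw [Fin.ext_iff, Fin.ext_iff, Fin.val_zero, Fin.val_last]
      omega

end Covariance

end CMSeq

theorem mainTheorem4 (N d : ℕ) (hN : 1 ≤ N) (b : CMSeq.ForwardModel)
    (G : Fin (N + 1) → Fin (N + 1) → Matrix (Fin d) (Fin d) ℝ)
    (Γ : Fin (N + 1) → Matrix (Fin d) (Fin d) ℝ) (hΓ : ∀ k, (Γ k).PosDef) :
    (∃ (Ω : Type) (_ : MeasurableSpace Ω) (μ : Measure Ω) (_ : IsProbabilityMeasure μ)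
      (X e : Fin (N + 1) → Ω → Fin d → ℝ), CMSeq.Governs b G Γ X e μ) ∧
    (∀ (Ω : Type*) [MeasurableSpace Ω] (μ : Measure Ω) [IsProbabilityMeasure μ]
      (X e : Fin (N + 1) → Ω → Fin d → ℝ), CMSeq.Governs b G Γ X e μ →
        CMSeq.IsZMNG X μ ∧
        (CMSeq.IsReciprocal X μ ↔ CMSeq.IsCyclicTridiagonal (CMSeq.matrixA b G Γ)) ∧
        (CMSeq.IsMarkov X μ ↔ CMSeq.IsTridiagonal (CMSeq.matrixA b G Γ))) :=
  ⟨CMSeq.exists_governs b G hN hΓ, fun _ _ _ _ _ _ h =>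
    ⟨h.isZMNG hN hΓ, h.isReciprocal_iff hN hΓ, h.isMarkov_iff hN hΓ⟩⟩
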